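/- Theorem 8. There is an absolute constant $C_2>0$ with the following property. Let $m\ge n$, $d$ and $1\le s\le mn$ be integers, let $\mu>0$, and let $D=X_0+E$, where $X_0\in\mathbb{R}^{m\times n}$ is a fixed matrix of rank at most $d$ and $E\in\mathbb{R}^{m\times n}$ is a random noise matrix (for instance Gaussian; its law may be arbitrary). Let $\Omega$ be uniformly distributed over the sets of exactly $s$ positions $(i,j)\in\{1,\dots,m\}\times\{1,\dots,n\}$, independently of $E$, so that $|\Omega|=s$; let $\mathcal P_\Omega$ be the projection that keeps the entries in $\Omega$ and sets all others to $0$; and put $\delta=\max_{i,j}|D_{ij}|$. Consider the problem $$\min_{U\in\mathbb{R}^{m\times d},\,V\in\mathbb{R}^{n\times d}}\ \frac{\|U\|_{\mathrm{tr}}+\|V\|_{\mathrm{tr}}}{2}+\frac{1}{2\mu}\,\|\mathcal P_\Omega(UV^T)-\mathcal P_\Omega(D)\|_F^2 ,$$ where $\|\cdot\|_{\mathrm{tr}}$ is the trace norm (the sum of the singular values) and $\|\cdot\|_F$ the Frobenius norm. Then, with probability at least $1-2\exp(-m)$, every critical point $(\widehat U,\widehat V)$ of this problem (that is, a point at which $0$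 is a limiting subgradient of the objective) such that $\widehat U\neq 0$ and $\max_{i,j}|D_{ij}-(\widehat U\widehat V^T)_{ij}|\le 2\delta$ (in particular, such that $\max_{i,j}|(\widehat U\widehat V^T)_{ij}|\le\delta$) satisfies $$\frac{\|X_0-\widehat U\widehat V^T\|_F}{\sqrt{mn}}\ \le\ \frac{\|E\|_F}{\sqrt{mn}}+C_2\,\delta\left(\frac{m d\log m}{|\Omega|}\right)^{1/4}+\frac{\mu\sqrt d}{2C_3\sqrt{|\Omega|}},\qquad C_3=\frac{\|\mathcal P_\Omega(D-\widehat U\widehat V^T)\widehat V\|_F}{\|\mathcal P_\Omega(D-\widehat U\widehat V^T)\|_F},$$ where $C_3$ is well defined and positive. -/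

import Mathlib

open MeasureTheory ProbabilityTheory Filter Topology
open scoped Matrix Matrix.Norms.Frobenius

noncomputable section

namespace BiTrace

/-- The trace (nuclear) norm of a real `a × b` matrix: the sum of its `min a b` largest singular
values (`singularValues k` is the `(k+1)`-st largest singular value). -/
def traceNorm {a b : ℕ} (A : Matrix (Fin a) (Fin b) ℝ) : ℝ :=
  ∑ k ∈ Finset.range (min a b), (Matrix.toEuclideanLin A).singularValues k

/-- The coordinate projection onto the set of observed positions. -/
def proj {m n : ℕ} (Ω : Finset (Fin m × Fin n)) (A : Matrix (Fin m) (Fin n) ℝ) :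
    Matrix (Fin m) (Fin n) ℝ :=
  Matrix.of fun i j => if (i, j) ∈ Ω then A i j else 0

/-- The objective of the bi-trace regularised matrix completion problem; `‖ ‖` is the Frobenius
norm. -/
def objective {m n : ℕ} (d : ℕ) (μ : ℝ) (Ω : Finset (Fin m × Fin n))
    (D : Matrix (Fin m) (Fin n) ℝ)
    (p : Matrix (Fin m) (Fin d) ℝ × Matrix (Fin n) (Fin d) ℝ) : ℝ :=
  (traceNorm p.1 + traceNorm p.2) / 2
    + 1 / (2 * μ) * ‖proj Ω (p.1 * p.2ᵀ) - proj Ω D‖ ^ 2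

/-- `φ` is a regular (Fréchet) subgradient of `f` at `x`. -/
def IsFrechetSubgradient {X : Type*} [NormedAddCommGroup X] [NormedSpace ℝ X]
    (f : X → ℝ) (x : X) (φ : X →L[ℝ] ℝ) : Prop :=
  ∀ ε : ℝ, 0 < ε → ∀ᶠ y in 𝓝 x, f x + φ (y - x) - ε * ‖y - x‖ ≤ f y

/-- `φ` is a limiting (Mordukhovich) subgradient of `f` at `x`. -/
def IsLimitingSubgradient {X : Type*} [NormedAddCommGroup X] [NormedSpace ℝ X]
    (f : X → ℝ) (x : X) (φ : X →L[ℝ] ℝ) : Prop :=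
  ∃ (y : ℕ → X) (ψ : ℕ → X →L[ℝ] ℝ),
    (∀ k, IsFrechetSubgradient f (y k) (ψ k)) ∧
    Tendsto y atTop (𝓝 x) ∧ Tendsto (fun k => f (y k)) atTop (𝓝 (f x)) ∧
    Tendsto ψ atTop (𝓝 φ)

/-- A critical point of a nonsmooth nonconvex function: zero is a limiting subgradient. -/
def IsCriticalPoint {X : Type*} [NormedAddCommGroup X] [NormedSpace ℝ X]
    (f : X → ℝ) (x : X) : Prop :=
  IsLimitingSubgradient f x 0

/-- The largest absolute value of an entry. -/
def maxEntry {m n : ℕ} (D : Matrix (Fin m) (Fin n) ℝ) : ℝ :=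
  ⨆ p : Fin m × Fin n, |D p.1 p.2|

/-- The ratio `‖P_Ω(D - U Vᵀ) V‖_F / ‖P_Ω(D - U Vᵀ)‖_F`. -/
def residualRatio {m n d : ℕ} (Ω : Finset (Fin m × Fin n)) (D : Matrix (Fin m) (Fin n) ℝ)
    (U : Matrix (Fin m) (Fin d) ℝ) (V : Matrix (Fin n) (Fin d) ℝ) : ℝ :=
  ‖proj Ω (D - U * Vᵀ) * V‖ / ‖proj Ω (D - U * Vᵀ)‖

/-- `S` is uniformly distributed over the subsets of `ι` with exactly `s` elements
(sampling without replacement). -/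
structure IsUniformSample {W : Type*} [MeasurableSpace W] {ι : Type*} [Fintype ι]
    (P : Measure W) (s : ℕ) (S : W → Finset ι) : Prop where
  measurable : Measurable S
  prob_eq : ∀ A : Finset ι, P {w | S w = A} =
    if A.card = s then (((Fintype.card ι).choose s : ℕ) : ENNReal)⁻¹ else 0

end BiTrace

end

/-!
Write `R = D - U Vᵀ`. At a critical point the trace norm, being convex, satisfies the first-order
inequality `‖U‖_tr + (2/μ) ⟪P_Ω(R) V, H⟫ ≤ ‖U + H‖_tr` in every direction `H` of the factor `U`.
The direction `H = P_Ω(R) V`, together with `‖H‖_tr ≤ √d ‖H‖_F`, bounds `‖P_Ω(R) V‖_F` by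
`μ √d / 2`, so that the observed residual `‖P_Ω(R)‖_F` is at most `μ √d / (2 C₃)`; the direction
`H = -U` shows that `P_Ω(R) V = 0` forces `U = 0`.

It remains to compare the mean squares of `R` over `Ω` and over all positions. For a fixed matrix
this is Hoeffding's inequality for sampling without replacement, whose exponential moments are
bounded by induction on the sample size, conditioning on the first drawn position. A union bound
over an entrywise net of the matrices of rank at most `d` extends it to all `U Vᵀ` at once; since
`δ` is random, the net is fixed at scale `1` and rescaled by `δ`.
-/

noncomputable section

namespace BiTrace

open scoped BigOperators

section Frobenius

variable {ι κ : Type*} [Fintype ι] [Fintype κ]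

theorem sq_norm_eq_sum (A : Matrix ι κ ℝ) : ‖A‖ ^ 2 = ∑ i, ∑ j, A i j ^ 2 := by
  rw [Matrix.frobenius_norm_def, ← Real.sqrt_eq_rpow, Real.sq_sqrt (by positivity)]
  simp

theorem trace_mul_transpose_eq_sum (A B : Matrix ι κ ℝ) :
    (A * Bᵀ).trace = ∑ i, ∑ j, A i j * B i j := rfl

theorem trace_mul_transpose_self (A : Matrix ι κ ℝ) : (A * Aᵀ).trace = ‖A‖ ^ 2 := by
  rw [sq_norm_eq_sum]
  simp only [trace_mul_transpose_eq_sum, sq]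

omit [Fintype ι] in
theorem toEuclideanLin_apply_eq_inner [DecidableEq κ] (A : Matrix ι κ ℝ) (v : EuclideanSpace ℝ κ)
    (i : ι) : Matrix.toEuclideanLin A v i = inner ℝ (WithLp.toLp 2 (A i)) v := by
  simp [Matrix.toEuclideanLin, Matrix.mulVec, dotProduct, PiLp.inner_apply, mul_comm]

theorem sum_sq_norm_toEuclideanLin [DecidableEq κ] {γ : Type*} [Fintype γ] (A : Matrix ι κ ℝ)
    (w : OrthonormalBasis γ ℝ (EuclideanSpace ℝ κ)) :
    ∑ j, ‖Matrix.toEuclideanLin A (w j)‖ ^ 2 = ‖A‖ ^ 2 := by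
  simp_rw [EuclideanSpace.real_norm_sq_eq, toEuclideanLin_apply_eq_inner, sq_norm_eq_sum]
  rw [Finset.sum_comm]
  refine Finset.sum_congr rfl fun i _ => ?_
  simpa [EuclideanSpace.real_norm_sq_eq] using w.sum_sq_norm_inner_left (WithLp.toLp 2 (A i))

end Frobenius

section TraceNorm

variable {a b : ℕ} (A B : Matrix (Fin a) (Fin b) ℝ)

theorem traceNorm_nonneg : 0 ≤ traceNorm A :=
  Finset.sum_nonneg fun _ _ => LinearMap.singularValues_nonneg _ _

theorem traceNorm_zero : traceNorm (0 : Matrix (Fin a) (Fin b) ℝ) = 0 := by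
  simp [traceNorm]

theorem traceNorm_eq_sum_range :
    traceNorm A = ∑ k ∈ Finset.range b, (Matrix.toEuclideanLin A).singularValues k := by
  have hrank : Module.finrank ℝ (Matrix.toEuclideanLin A).range ≤ a :=
    (Submodule.finrank_le _).trans finrank_euclideanSpace_fin.le
  refine Finset.sum_subset (Finset.range_subset_range.2 (min_le_right _ _)) fun k hk hk' => ?_
  rw [Finset.mem_range] at hk hk'
  exact (LinearMap.singularValues_eq_zero_iff_le_finrank_range _).2 (by omega)

theorem exists_orthonormalBasis_traceNorm_eq :
    ∃ w : OrthonormalBasis (Fin b) ℝ (EuclideanSpace ℝ (Fin b)),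
      (Pairwise fun i j =>
        inner ℝ (Matrix.toEuclideanLin A (w i)) (Matrix.toEuclideanLin A (w j)) = 0) ∧
      traceNorm A = ∑ j, ‖Matrix.toEuclideanLin A (w j)‖ := by
  rw [traceNorm_eq_sum_range, Finset.sum_range]
  set T := Matrix.toEuclideanLin A
  have hb : Module.finrank ℝ (EuclideanSpace ℝ (Fin b)) = b := finrank_euclideanSpace_fin
  have hT := T.isSymmetric_adjoint_comp_self
  set w := hT.eigenvectorBasis hb
  have hinner (i j) : inner ℝ (T (w i)) (T (w j)) = hT.eigenvalues hb j * inner ℝ (w i) (w j) := by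
    rw [← LinearMap.adjoint_inner_right, ← LinearMap.comp_apply, hT.apply_eigenvectorBasis hb j,
      inner_smul_right]
    rfl
  refine ⟨w, fun i j hij => ?_, Finset.sum_congr rfl fun j _ => ?_⟩
  · simp only [hinner, w.orthonormal.2 hij, mul_zero]
  · rw [T.singularValues_fin hb, norm_eq_sqrt_real_inner, hinner]
    simp

variable {A} in
theorem eq_zero_of_traceNorm_eq_zero (h : traceNorm A = 0) : A = 0 := by
  obtain ⟨w, -, hw⟩ := exists_orthonormalBasis_traceNorm_eq A
  rw [h, eq_comm, Finset.sum_eq_zero_iff_of_nonneg fun _ _ => norm_nonneg _] at hw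
  rw [← norm_eq_zero, ← sq_eq_zero_iff, ← sum_sq_norm_toEuclideanLin A w]
  exact Finset.sum_eq_zero fun j hj => by rw [hw j hj, zero_pow two_ne_zero]

theorem traceNorm_le_sqrt_mul_norm : traceNorm A ≤ √(b : ℝ) * ‖A‖ := by
  obtain ⟨w, -, hw⟩ := exists_orthonormalBasis_traceNorm_eq A
  refine le_of_sq_le_sq ?_ (by positivity)
  rw [hw, mul_pow, Real.sq_sqrt (Nat.cast_nonneg _), ← sum_sq_norm_toEuclideanLin A w]
  simpa using sq_sum_le_card_mul_sum_sq (s := Finset.univ)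
    (f := fun j => ‖Matrix.toEuclideanLin A (w j)‖)

theorem sum_inner_mul_inner_le {γ E F : Type*} [Fintype γ] [NormedAddCommGroup E]
    [InnerProductSpace ℝ E] [NormedAddCommGroup F] [InnerProductSpace ℝ F] {u : γ → E} {v : γ → F}
    (hu : Orthonormal ℝ u) (hv : Orthonormal ℝ v) (x : E) (y : F) :
    ∑ k, inner ℝ (u k) x * inner ℝ (v k) y ≤ ‖x‖ * ‖y‖ := by
  have hx : ∑ k, inner ℝ (u k) x ^ 2 ≤ ‖x‖ ^ 2 := by
    simpa using hu.sum_inner_products_le x (s := Finset.univ)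
  have hy : ∑ k, inner ℝ (v k) y ^ 2 ≤ ‖y‖ ^ 2 := by
    simpa using hv.sum_inner_products_le y (s := Finset.univ)
  calc ∑ k, inner ℝ (u k) x * inner ℝ (v k) y
      ≤ √(∑ k, inner ℝ (u k) x ^ 2) * √(∑ k, inner ℝ (v k) y ^ 2) :=
        Real.sum_mul_le_sqrt_mul_sqrt _ _ _
    _ ≤ √(‖x‖ ^ 2) * √(‖y‖ ^ 2) := by gcongr
    _ = ‖x‖ * ‖y‖ := by rw [Real.sqrt_sq (norm_nonneg x), Real.sqrt_sq (norm_nonneg y)]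

theorem sum_inner_toEuclideanLin_le_traceNorm {γ : Type*} [Fintype γ]
    {u : γ → EuclideanSpace ℝ (Fin a)} {v : γ → EuclideanSpace ℝ (Fin b)}
    (hu : Orthonormal ℝ u) (hv : Orthonormal ℝ v) :
    ∑ k, inner ℝ (u k) (Matrix.toEuclideanLin A (v k)) ≤ traceNorm A := by
  obtain ⟨w, -, hw⟩ := exists_orthonormalBasis_traceNorm_eq A
  have hexpand (k) : inner ℝ (u k) (Matrix.toEuclideanLin A (v k))
      = ∑ j, inner ℝ (v k) (w j) * inner ℝ (u k) (Matrix.toEuclideanLin A (w j)) := by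
    conv_lhs => rw [← w.sum_repr (v k)]
    simp only [map_sum, inner_sum, map_smul, inner_smul_right, w.repr_apply_apply,
      real_inner_comm]
  simp_rw [hexpand]
  rw [Finset.sum_comm, hw]
  refine Finset.sum_le_sum fun j _ => (sum_inner_mul_inner_le hv hu _ _).trans ?_
  rw [w.orthonormal.1 j, one_mul]

theorem exists_orthonormal_traceNorm_eq_sum_inner :
    ∃ (γ : Type) (_ : Fintype γ) (u : γ → EuclideanSpace ℝ (Fin a))
      (v : γ → EuclideanSpace ℝ (Fin b)), Orthonormal ℝ u ∧ Orthonormal ℝ v ∧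
      traceNorm A = ∑ k, inner ℝ (u k) (Matrix.toEuclideanLin A (v k)) := by
  classical
  obtain ⟨w, horth, hw⟩ := exists_orthonormalBasis_traceNorm_eq A
  set T := Matrix.toEuclideanLin A
  refine ⟨{j : Fin b // T (w j) ≠ 0}, inferInstance, fun k => ‖T (w k)‖⁻¹ • T (w k),
    fun k => w k, ⟨fun k => ?_, fun k l hkl => ?_⟩,
    w.orthonormal.comp _ Subtype.val_injective, ?_⟩
  · rw [norm_smul, norm_inv, norm_norm, inv_mul_cancel₀ (norm_ne_zero_iff.2 k.2)]
  · simp only [inner_smul_left, inner_smul_right, horth (Subtype.coe_ne_coe.2 hkl), mul_zero]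
  · have hnormalized (j) : inner ℝ (‖T (w j)‖⁻¹ • T (w j)) (T (w j)) = ‖T (w j)‖ := by
      rw [real_inner_smul_left, real_inner_self_eq_norm_mul_norm, ← mul_assoc,
        inv_mul_mul_self]
    simp_rw [hnormalized, hw]
    rw [← Finset.sum_subset (Finset.subset_univ {j | T (w j) ≠ 0}) fun j _ hj => by simpa using hj,
      ← Finset.sum_subtype_eq_sum_filter, Finset.subtype_univ]

theorem traceNorm_smul_add_smul_le {s t : ℝ} (hs : 0 ≤ s) (ht : 0 ≤ t) :
    traceNorm (s • A + t • B) ≤ s * traceNorm A + t * traceNorm B := by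
  obtain ⟨γ, _, u, v, hu, hv, h⟩ := exists_orthonormal_traceNorm_eq_sum_inner (s • A + t • B)
  simp only [h, map_add, map_smul, LinearMap.add_apply, LinearMap.smul_apply, inner_add_right,
    inner_smul_right, Finset.sum_add_distrib, ← Finset.mul_sum]
  gcongr <;> exact sum_inner_toEuclideanLin_le_traceNorm _ hu hv

theorem traceNorm_add_le : traceNorm (A + B) ≤ traceNorm A + traceNorm B := by
  simpa using traceNorm_smul_add_smul_le A B zero_le_one zero_le_one

theorem convexOn_traceNorm :
    ConvexOn ℝ Set.univ (traceNorm : Matrix (Fin a) (Fin b) ℝ → ℝ) :=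
  ⟨convex_univ, fun A _ B _ _ _ hs ht _ => traceNorm_smul_add_smul_le A B hs ht⟩

end TraceNorm

section Subgradient

variable {X : Type*} [NormedAddCommGroup X] [NormedSpace ℝ X]

theorem IsFrechetSubgradient.sub {f q : X → ℝ} {y : X} {q' ψ : X →L[ℝ] ℝ}
    (h : IsFrechetSubgradient f y ψ) (hq : HasFDerivAt q q' y) :
    IsFrechetSubgradient (fun x => f x - q x) y (ψ - q') := by
  intro ε hε
  filter_upwards [h (ε / 2) (by positivity), hq.isLittleO.def (half_pos hε)] with x hf hx
  have hq_le := (le_abs_self _).trans hx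
  rw [sub_apply]
  linarith

theorem IsFrechetSubgradient.le_of_convexOn {g : X → ℝ} {y : X} {ψ : X →L[ℝ] ℝ}
    (h : IsFrechetSubgradient g y ψ) (hg : ConvexOn ℝ Set.univ g) (z : X) :
    g y + ψ (z - y) ≤ g z := by
  have hbound (ε : ℝ) (hε : 0 < ε) : g y + ψ (z - y) - ε * ‖z - y‖ ≤ g z := by
    have hpath : Tendsto (fun t : ℝ => y + t • (z - y)) (𝓝[>] 0) (𝓝 y) := by
      have hcont : Continuous fun t : ℝ => y + t • (z - y) := by fun_prop
      simpa using (hcont.tendsto 0).mono_left nhdsWithin_le_nhds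
    obtain ⟨t, hsub, ht₀, ht₁⟩ :=
      ((hpath.eventually (h ε hε)).and (Ioo_mem_nhdsGT one_pos)).exists
    have hconv := hg.2 (Set.mem_univ y) (Set.mem_univ z) (sub_nonneg.2 ht₁.le) ht₀.le (by ring)
    rw [show (1 - t) • y + t • z = y + t • (z - y) by module, smul_eq_mul, smul_eq_mul] at hconv
    rw [add_sub_cancel_left, map_smul, norm_smul, Real.norm_of_nonneg ht₀.le, smul_eq_mul] at hsub
    have hscaled : t * (g y + ψ (z - y) - ε * ‖z - y‖) ≤ t * g z := by linarith
    exact le_of_mul_le_mul_left hscaled ht₀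
  have hlim : Tendsto (fun ε : ℝ => g y + ψ (z - y) - ε * ‖z - y‖) (𝓝[>] 0)
      (𝓝 (g y + ψ (z - y))) := by
    have hcont : Continuous fun ε : ℝ => g y + ψ (z - y) - ε * ‖z - y‖ := by fun_prop
    simpa using (hcont.tendsto 0).mono_left nhdsWithin_le_nhds
  exact le_of_tendsto hlim (eventually_mem_nhdsWithin.mono hbound)

theorem IsCriticalPoint.le_of_convexOn_add {g q : X → ℝ} (hg : ConvexOn ℝ Set.univ g)
    (hg_cont : Continuous g) (hq : ContDiff ℝ 1 q) {x v : X} {c : ℝ}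
    (h : IsCriticalPoint (fun x => g x + q x) x) (hc : HasLineDerivAt ℝ q c x v) :
    g x ≤ g (x + v) + c := by
  obtain ⟨y, ψ, hsub, hy, -, hψ⟩ := h
  have hdiff : Differentiable ℝ q := hq.differentiable one_ne_zero
  have hg_sub (k) : g (y k) + (ψ k - fderiv ℝ q (y k)) (x + v - y k) ≤ g (x + v) := by
    refine IsFrechetSubgradient.le_of_convexOn ?_ hg (x + v)
    simpa using (hsub k).sub (hdiff (y k)).hasFDerivAt
  have hlim_fun : Tendsto (fun k => ψ k - fderiv ℝ q (y k)) atTop (𝓝 (0 - fderiv ℝ q x)) :=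
    hψ.sub (((hq.continuous_fderiv one_ne_zero).tendsto x).comp hy)
  have hlim_dir : Tendsto (fun k => x + v - y k) atTop (𝓝 (x + v - x)) :=
    tendsto_const_nhds.sub hy
  have hle := le_of_tendsto' (((hg_cont.tendsto x).comp hy).add
    ((isBoundedBilinearMap_apply.continuous.tendsto (0 - fderiv ℝ q x, x + v - x)).comp
      (hlim_fun.prodMk_nhds hlim_dir))) hg_sub
  rw [zero_sub, neg_apply, add_sub_cancel_left,
    ((hdiff x).hasFDerivAt.hasLineDerivAt v).unique hc] at hle
  linarith

end Subgradient

section Objective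

variable {m n d : ℕ} (μ : ℝ) (Ω : Finset (Fin m × Fin n)) (D : Matrix (Fin m) (Fin n) ℝ)

theorem proj_sub (A B : Matrix (Fin m) (Fin n) ℝ) : proj Ω (A - B) = proj Ω A - proj Ω B := by
  ext i j
  simp only [proj, Matrix.of_apply, Matrix.sub_apply]
  split_ifs <;> simp

theorem trace_proj_mul_transpose (A B : Matrix (Fin m) (Fin n) ℝ) :
    (proj Ω A * Bᵀ).trace = ∑ p ∈ Ω, A p.1 p.2 * B p.1 p.2 := by
  rw [trace_mul_transpose_eq_sum, ← Finset.sum_product', Finset.univ_product_univ]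
  simp [proj, Finset.sum_ite_mem]

theorem sq_norm_proj (A : Matrix (Fin m) (Fin n) ℝ) :
    ‖proj Ω A‖ ^ 2 = ∑ p ∈ Ω, A p.1 p.2 ^ 2 := by
  rw [← trace_mul_transpose_self, trace_proj_mul_transpose]
  exact Finset.sum_congr rfl fun p hp => by simp [proj, hp, sq]

theorem sq_norm_proj_add_smul (A B : Matrix (Fin m) (Fin n) ℝ) (t : ℝ) :
    ‖proj Ω (A + t • B)‖ ^ 2
      = ‖proj Ω A‖ ^ 2 + 2 * t * (proj Ω A * Bᵀ).trace + t ^ 2 * ‖proj Ω B‖ ^ 2 := by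
  simp only [sq_norm_proj, trace_proj_mul_transpose, Finset.mul_sum, ← Finset.sum_add_distrib]
  exact Finset.sum_congr rfl fun p _ => by
    rw [Matrix.add_apply, Matrix.smul_apply, smul_eq_mul]; ring

/-- The quadratic data-fidelity term of the objective, which is its smooth part. -/
def dataFit (p : Matrix (Fin m) (Fin d) ℝ × Matrix (Fin n) (Fin d) ℝ) : ℝ :=
  1 / (2 * μ) * ‖proj Ω (p.1 * p.2ᵀ) - proj Ω D‖ ^ 2

theorem dataFit_eq (p : Matrix (Fin m) (Fin d) ℝ × Matrix (Fin n) (Fin d) ℝ) :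
    dataFit μ Ω D p = 1 / (2 * μ) * ‖proj Ω (D - p.1 * p.2ᵀ)‖ ^ 2 := by
  rw [dataFit, norm_sub_rev, proj_sub]

theorem contDiff_dataFit : ContDiff ℝ 1 (dataFit (d := d) μ Ω D) := by
  have hleft (i k) : ContDiff ℝ 1
      fun p : Matrix (Fin m) (Fin d) ℝ × Matrix (Fin n) (Fin d) ℝ => p.1 i k :=
    (Matrix.entryLinearMap ℝ ℝ i k).toContinuousLinearMap.contDiff.comp contDiff_fst
  have hright (j k) : ContDiff ℝ 1
      fun p : Matrix (Fin m) (Fin d) ℝ × Matrix (Fin n) (Fin d) ℝ => p.2 j k :=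
    (Matrix.entryLinearMap ℝ ℝ j k).toContinuousLinearMap.contDiff.comp contDiff_snd
  have hsum : dataFit (d := d) μ Ω D = fun p =>
      1 / (2 * μ) * ∑ e ∈ Ω, (D e.1 e.2 - ∑ k, p.1 e.1 k * p.2 e.2 k) ^ 2 := by
    funext p
    rw [dataFit_eq, sq_norm_proj]
    rfl
  rw [hsum]
  exact contDiff_const.mul (ContDiff.sum fun e _ =>
    (contDiff_const.sub (ContDiff.sum fun k _ => (hleft _ k).mul (hright _ k))).pow 2)

theorem hasLineDerivAt_dataFit_left (U H : Matrix (Fin m) (Fin d) ℝ)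
    (V : Matrix (Fin n) (Fin d) ℝ) :
    HasLineDerivAt ℝ (dataFit μ Ω D) (-(1 / μ) * (proj Ω (D - U * Vᵀ) * V * Hᵀ).trace)
      (U, V) (H, 0) := by
  set R := D - U * Vᵀ
  have hexpand (t : ℝ) : dataFit μ Ω D ((U, V) + t • (H, 0)) = 1 / (2 * μ) *
      (‖proj Ω R‖ ^ 2 + 2 * t * -(proj Ω R * V * Hᵀ).trace
        + t ^ 2 * ‖proj Ω (-(H * Vᵀ))‖ ^ 2) := by
    have hres : D - (U + t • H) * Vᵀ = R + t • -(H * Vᵀ) := by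
      rw [Matrix.add_mul, Matrix.smul_mul, smul_neg, ← sub_eq_add_neg, sub_sub]
    simp only [dataFit_eq, Prod.smul_mk, Prod.mk_add_mk, smul_zero, add_zero]
    rw [hres, sq_norm_proj_add_smul, Matrix.transpose_neg, Matrix.transpose_mul,
      Matrix.transpose_transpose, Matrix.mul_neg, Matrix.trace_neg, Matrix.mul_assoc]
  simp only [HasLineDerivAt, hexpand]
  have hlin := ((hasDerivAt_id (0 : ℝ)).const_mul 2).mul_const (-(proj Ω R * V * Hᵀ).trace)
  have hquad := ((hasDerivAt_id (0 : ℝ)).pow 2).mul_const (‖proj Ω (-(H * Vᵀ))‖ ^ 2)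
  convert! ((hlin.const_add (‖proj Ω R‖ ^ 2)).add hquad).const_mul (1 / (2 * μ)) using 1
  simp only [id_eq, one_div, mul_inv]
  ring

theorem convexOn_half_traceNorm_add :
    ConvexOn ℝ Set.univ fun p : Matrix (Fin m) (Fin d) ℝ × Matrix (Fin n) (Fin d) ℝ =>
      (traceNorm p.1 + traceNorm p.2) / 2 := by
  have hleft := (convexOn_traceNorm (a := m) (b := d)).comp_linearMap
    (LinearMap.fst ℝ _ (Matrix (Fin n) (Fin d) ℝ))
  have hright := (convexOn_traceNorm (a := n) (b := d)).comp_linearMap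
    (LinearMap.snd ℝ (Matrix (Fin m) (Fin d) ℝ) _)
  refine ((hleft.add hright).smul (c := (1 / 2 : ℝ)) (by norm_num)).congr fun p _ => ?_
  simp only [Pi.add_apply, Function.comp_apply, LinearMap.fst_apply, LinearMap.snd_apply,
    smul_eq_mul]
  ring

variable {μ Ω D} {U : Matrix (Fin m) (Fin d) ℝ} {V : Matrix (Fin n) (Fin d) ℝ}

theorem IsCriticalPoint.traceNorm_add_trace_le (h : IsCriticalPoint (objective d μ Ω D) (U, V))
    (H : Matrix (Fin m) (Fin d) ℝ) :
    traceNorm U + 2 / μ * (proj Ω (D - U * Vᵀ) * V * Hᵀ).trace ≤ traceNorm (U + H) := by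
  have hcont := continuousOn_univ.1 <|
    (convexOn_half_traceNorm_add (m := m) (n := n) (d := d)).continuousOn isOpen_univ
  have hle := IsCriticalPoint.le_of_convexOn_add convexOn_half_traceNorm_add hcont
    (contDiff_dataFit μ Ω D) h (hasLineDerivAt_dataFit_left μ Ω D U H V)
  simp only [Prod.mk_add_mk, add_zero] at hle
  linear_combination 2 * hle

theorem IsCriticalPoint.norm_proj_mul_le (hμ : 0 < μ)
    (h : IsCriticalPoint (objective d μ Ω D) (U, V)) :
    ‖proj Ω (D - U * Vᵀ) * V‖ ≤ μ * √(d : ℝ) / 2 := by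
  set Y := proj Ω (D - U * Vᵀ) * V
  have hle : 2 / μ * ‖Y‖ ^ 2 ≤ √(d : ℝ) * ‖Y‖ := by
    have hY := h.traceNorm_add_trace_le Y
    rw [trace_mul_transpose_self] at hY
    linarith [traceNorm_add_le U Y, traceNorm_le_sqrt_mul_norm Y]
  rcases (norm_nonneg Y).eq_or_lt with hY | hY
  · rw [← hY]; positivity
  · rw [div_mul_eq_mul_div, div_le_iff₀ hμ] at hle
    exact le_of_mul_le_mul_right (by linarith) hY

theorem IsCriticalPoint.proj_mul_ne_zero (h : IsCriticalPoint (objective d μ Ω D) (U, V))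
    (hU : U ≠ 0) : proj Ω (D - U * Vᵀ) * V ≠ 0 := by
  intro hzero
  have hle := h.traceNorm_add_trace_le (-U)
  rw [hzero, Matrix.zero_mul, Matrix.trace_zero, mul_zero, add_zero, add_neg_cancel,
    traceNorm_zero] at hle
  exact hU (eq_zero_of_traceNorm_eq_zero (hle.antisymm (traceNorm_nonneg U)))

theorem IsCriticalPoint.residualRatio_pos (h : IsCriticalPoint (objective d μ Ω D) (U, V))
    (hU : U ≠ 0) : 0 < residualRatio Ω D U V := by
  have hnum := h.proj_mul_ne_zero hU
  refine div_pos (norm_pos_iff.2 hnum) (norm_pos_iff.2 fun hden => hnum ?_)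
  rw [hden, Matrix.zero_mul]

theorem IsCriticalPoint.norm_proj_le (hμ : 0 < μ)
    (h : IsCriticalPoint (objective d μ Ω D) (U, V)) (hU : U ≠ 0) :
    ‖proj Ω (D - U * Vᵀ)‖ ≤ μ * √(d : ℝ) / (2 * residualRatio Ω D U V) := by
  have hratio := h.residualRatio_pos hU
  have hnorm : ‖proj Ω (D - U * Vᵀ)‖ ≠ 0 := fun hzero => by
    rw [residualRatio, hzero, div_zero] at hratio
    exact hratio.false
  have hmul : ‖proj Ω (D - U * Vᵀ)‖ * residualRatio Ω D U V = ‖proj Ω (D - U * Vᵀ) * V‖ :=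
    mul_div_cancel₀ _ hnorm
  rw [le_div_iff₀ (by positivity)]
  linarith [h.norm_proj_mul_le hμ]

end Objective

section Sampling

variable {ι : Type*}

theorem sum_powersetCard_succ [DecidableEq ι] (S : Finset ι) (k : ℕ) (h : Finset ι → ℝ) :
    ∑ i ∈ S, ∑ B ∈ (S.erase i).powersetCard k, h (insert i B)
      = (k + 1) * ∑ A ∈ S.powersetCard (k + 1), h A := by
  have hcount : (k + 1) * ∑ A ∈ S.powersetCard (k + 1), h A
      = ∑ A ∈ S.powersetCard (k + 1), ∑ _i ∈ A, h A := by
    rw [Finset.mul_sum]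
    refine Finset.sum_congr rfl fun A hA => ?_
    rw [Finset.sum_const, (Finset.mem_powersetCard.1 hA).2, nsmul_eq_mul, Nat.cast_succ]
  rw [hcount, Finset.sum_sigma', Finset.sum_sigma']
  refine Finset.sum_bij' (fun x _ => ⟨insert x.1 x.2, x.1⟩) (fun x _ => ⟨x.2, x.1.erase x.2⟩)
    ?_ ?_ ?_ ?_ fun _ _ => rfl
  all_goals
    rintro ⟨x, y⟩ hxy
    simp only [Finset.mem_sigma, Finset.mem_powersetCard, Finset.subset_erase] at hxy ⊢
  · grind
  · grind
  · rw [Finset.erase_insert hxy.2.1.2]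
  · rw [Finset.insert_erase hxy.2]

theorem expect_powersetCard_succ [DecidableEq ι] (S : Finset ι) (k : ℕ) (h : Finset ι → ℝ) :
    𝔼 A ∈ S.powersetCard (k + 1), h A
      = 𝔼 i ∈ S, 𝔼 B ∈ (S.erase i).powersetCard k, h (insert i B) := by
  have hinner (i) (hi : i ∈ S) : 𝔼 B ∈ (S.erase i).powersetCard k, h (insert i B)
      = (∑ B ∈ (S.erase i).powersetCard k, h (insert i B)) / (S.card - 1).choose k := by
    rw [Finset.expect_eq_sum_div_card, Finset.card_powersetCard, Finset.card_erase_of_mem hi]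
  rw [Finset.expect_congr rfl hinner, ← Finset.expect_div, Finset.expect_eq_sum_div_card,
    Finset.expect_eq_sum_div_card, sum_powersetCard_succ, Finset.card_powersetCard, div_div]
  rcases S.eq_empty_or_nonempty with rfl | hS
  · simp
  obtain ⟨N, hN⟩ := Nat.exists_eq_succ_of_ne_zero hS.card_ne_zero
  have hchoose : ((N + 1 : ℕ) : ℝ) * N.choose k = (k + 1) * (N + 1).choose (k + 1) := by
    rw [mul_comm ((k : ℝ) + 1)]
    exact_mod_cast Nat.add_one_mul_choose_eq N k
  rw [hN, Nat.succ_eq_add_one, Nat.add_sub_cancel, hchoose, mul_div_mul_left _ _ (by positivity)]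

theorem expect_exp_le {S : Finset ι} {y : ι → ℝ} {b : ℝ} (hy : ∀ i ∈ S, |y i| ≤ b)
    (hmean : 𝔼 i ∈ S, y i = 0) : 𝔼 i ∈ S, Real.exp (y i) ≤ Real.exp (b ^ 2 / 2) := by
  rcases S.eq_empty_or_nonempty with rfl | ⟨i₀, hi₀⟩
  · simpa using (Real.exp_pos _).le
  rcases ((abs_nonneg _).trans (hy i₀ hi₀)).eq_or_lt with rfl | hb
  · exact Finset.expect_le ⟨i₀, hi₀⟩ fun i hi => by simp [abs_nonpos_iff.1 (hy i hi)]
  have hchord (i) (hi : i ∈ S) : Real.exp (y i) ≤ Real.cosh b + y i * (Real.sinh b / b) := by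
    have h := Real.exp_mul_le_cosh_add_mul_sinh (t := y i / b)
      (by rw [abs_div, abs_of_pos hb]; exact (div_le_one hb).2 (hy i hi)) b
    rwa [div_mul_cancel₀ _ hb.ne', div_mul_eq_mul_div, mul_div_assoc] at h
  calc 𝔼 i ∈ S, Real.exp (y i)
      ≤ 𝔼 i ∈ S, (Real.cosh b + y i * (Real.sinh b / b)) := Finset.expect_le_expect hchord
    _ = Real.cosh b := by
        rw [Finset.expect_add_distrib, Finset.expect_const ⟨i₀, hi₀⟩, ← Finset.expect_mul, hmean,
          zero_mul, add_zero]
    _ ≤ Real.exp (b ^ 2 / 2) := Real.cosh_le_exp_half_sq b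

theorem expect_exp_mul_sub_expect_le {S : Finset ι} {g : ι → ℝ} {a b : ℝ}
    (hg : ∀ i ∈ S, g i ∈ Set.Icc a b) (c : ℝ) :
    𝔼 i ∈ S, Real.exp (c * (g i - 𝔼 j ∈ S, g j)) ≤ Real.exp ((c * (b - a)) ^ 2 / 2) := by
  rcases S.eq_empty_or_nonempty with rfl | hS
  · simpa using (Real.exp_pos _).le
  set M := 𝔼 j ∈ S, g j
  have hM : M ∈ Set.Icc a b := ⟨Finset.le_expect hS fun i hi => (hg i hi).1,
    Finset.expect_le hS fun i hi => (hg i hi).2⟩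
  have hbound (i) (hi : i ∈ S) : |c * (g i - M)| ≤ |c * (b - a)| := by
    rw [abs_mul, abs_mul]
    exact mul_le_mul_of_nonneg_left
      ((Real.dist_le_of_mem_Icc (hg i hi) hM).trans (le_abs_self _)) (abs_nonneg _)
  have hmean : 𝔼 i ∈ S, c * (g i - M) = 0 := by
    rw [← Finset.mul_expect, Finset.expect_sub_distrib, Finset.expect_const hS, sub_self, mul_zero]
  simpa only [sq_abs] using expect_exp_le hbound hmean

theorem sum_insert_sub_mul_expect [DecidableEq ι] {S B : Finset ι} {i : ι} {k : ℕ} (hi : i ∈ S)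
    (hB : B ∈ (S.erase i).powersetCard k) (hk : k < S.card) (g : ι → ℝ) :
    ∑ j ∈ insert i B, g j - (k + 1) * 𝔼 j ∈ S, g j
      = (1 - k / (S.card - 1)) * (g i - 𝔼 j ∈ S, g j)
        + (∑ j ∈ B, g j - k * 𝔼 j ∈ S.erase i, g j) := by
  have hiB : i ∉ B := fun h => Finset.notMem_erase i S ((Finset.mem_powersetCard.1 hB).1 h)
  have hsum : ∑ j ∈ S.erase i, g j = ∑ j ∈ S, g j - g i := by
    rw [← Finset.add_sum_erase S g hi, add_sub_cancel_left]
  obtain ⟨N, hN⟩ := Nat.exists_eq_succ_of_ne_zero (Finset.card_ne_zero_of_mem hi)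
  rw [Finset.sum_insert hiB, Finset.expect_eq_sum_div_card, Finset.expect_eq_sum_div_card, hsum,
    Finset.card_erase_of_mem hi, hN, Nat.succ_sub_one, Nat.cast_succ, add_sub_cancel_right]
  rcases N.eq_zero_or_pos with rfl | hN₀
  · obtain rfl : k = 0 := by omega
    simp [add_sub_right_comm]
  · field_simp
    ring

theorem expect_exp_sum_sub_le {g : ι → ℝ} {a b : ℝ} (lam : ℝ) {S : Finset ι}
    (hg : ∀ i ∈ S, g i ∈ Set.Icc a b) {k : ℕ} (hk : k ≤ S.card) :
    𝔼 A ∈ S.powersetCard k, Real.exp (lam * (∑ i ∈ A, g i - k * 𝔼 i ∈ S, g i))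
      ≤ Real.exp (k * ((lam * (b - a)) ^ 2 / 2)) := by
  classical
  induction k generalizing S with
  | zero => simp
  | succ k ih =>
    set M := 𝔼 i ∈ S, g i
    set c : ℝ := 1 - k / (S.card - 1)
    have hc : c ^ 2 ≤ 1 := by
      have hk' : (k : ℝ) ≤ S.card - 1 := le_sub_iff_add_le.2 (by exact_mod_cast hk)
      have hle := div_le_one_of_le₀ hk' (k.cast_nonneg.trans hk')
      have hnonneg := div_nonneg (k.cast_nonneg (α := ℝ)) (k.cast_nonneg.trans hk')
      exact (sq_le_one_iff_abs_le_one _).2 (abs_le.2 ⟨by linarith, by linarith⟩)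
    have hcond (i) (hi : i ∈ S) : 𝔼 B ∈ (S.erase i).powersetCard k,
          Real.exp (lam * (∑ j ∈ insert i B, g j - (k + 1 : ℕ) * M))
        ≤ Real.exp (lam * c * (g i - M)) * Real.exp (k * ((lam * (b - a)) ^ 2 / 2)) := by
      have hi_card : k ≤ (S.erase i).card := by rw [Finset.card_erase_of_mem hi]; omega
      refine le_trans (le_of_eq ?_) (mul_le_mul_of_nonneg_left
        (ih (fun j hj => hg j (Finset.mem_of_mem_erase hj)) hi_card) (Real.exp_pos _).le)
      rw [Finset.mul_expect _ _ (Real.exp _)]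
      refine Finset.expect_congr rfl fun B hB => ?_
      rw [← Real.exp_add, Nat.cast_succ, sum_insert_sub_mul_expect hi hB hk, mul_add, mul_assoc]
    rw [expect_powersetCard_succ]
    refine (Finset.expect_le_expect hcond).trans ?_
    rw [← Finset.expect_mul]
    calc (𝔼 i ∈ S, Real.exp (lam * c * (g i - M))) * Real.exp (k * ((lam * (b - a)) ^ 2 / 2))
        ≤ Real.exp ((lam * c * (b - a)) ^ 2 / 2) * Real.exp (k * ((lam * (b - a)) ^ 2 / 2)) := by
          gcongr
          exact expect_exp_mul_sub_expect_le hg _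
      _ ≤ Real.exp ((k + 1 : ℕ) * ((lam * (b - a)) ^ 2 / 2)) := by
          rw [← Real.exp_add, Real.exp_le_exp]
          push_cast
          linear_combination (lam * (b - a)) ^ 2 / 2 * hc

theorem card_expect_add_lt_expect_le {g : ι → ℝ} {a b t : ℝ} {S : Finset ι}
    (hg : ∀ i ∈ S, g i ∈ Set.Icc a b) (ht : 0 ≤ t) {s : ℕ} (hs : s ≤ S.card) :
    ({A ∈ S.powersetCard s | 𝔼 i ∈ A, g i + t < 𝔼 i ∈ S, g i}.card : ℝ)
      ≤ S.card.choose s * Real.exp (-(s * t ^ 2 / (2 * (b - a) ^ 2))) := by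
  set M := 𝔼 i ∈ S, g i
  set F := {A ∈ S.powersetCard s | 𝔼 i ∈ A, g i + t < M}
  set r := t / (b - a) ^ 2
  set φ : Finset ι → ℝ := fun A => Real.exp (-r * (∑ i ∈ A, g i - s * M))
  have hlower (A) (hA : A ∈ F) : Real.exp (r * (s * t)) ≤ φ A := by
    obtain ⟨hA, hlt⟩ := Finset.mem_filter.1 hA
    rw [Real.exp_le_exp, ← Finset.card_mul_expect, (Finset.mem_powersetCard.1 hA).2, neg_mul,
      ← mul_neg, ← mul_sub, ← mul_neg]
    gcongr
    linarith
  have hmarkov : F.card * Real.exp (r * (s * t)) ≤ ∑ A ∈ S.powersetCard s, φ A := by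
    rw [← nsmul_eq_mul]
    exact (Finset.card_nsmul_le_sum _ _ _ hlower).trans (Finset.sum_le_sum_of_subset_of_nonneg
      (Finset.filter_subset _ _) fun _ _ _ => (Real.exp_pos _).le)
  have hmgf : ∑ A ∈ S.powersetCard s, φ A
      ≤ S.card.choose s * Real.exp (s * ((-r * (b - a)) ^ 2 / 2)) := by
    rw [← Finset.card_mul_expect, Finset.card_powersetCard]
    gcongr
    exact expect_exp_sum_sub_le (-r) hg hs
  have hexponent : s * ((-r * (b - a)) ^ 2 / 2) - r * (s * t)
      = -(s * t ^ 2 / (2 * (b - a) ^ 2)) := by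
    rcases eq_or_ne (b - a) 0 with hab | hab
    · simp [r, hab]
    · simp only [r]
      field_simp
      ring
  rw [← hexponent, Real.exp_sub, ← mul_div_assoc, le_div_iff₀ (Real.exp_pos _)]
  exact hmarkov.trans hmgf

end Sampling

section Uniform

variable {ι W : Type*} [Fintype ι] [MeasurableSpace W] {P : Measure W} {s : ℕ} {Ω : W → Finset ι}

theorem IsUniformSample.map_apply (hΩ : IsUniformSample P s Ω) (T : Set (Finset ι)) :
    P.map Ω T = ({A ∈ T | A.card = s}.ncard : ENNReal) / (Fintype.card ι).choose s := by
  classical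
  lift T to Finset (Finset ι) using T.toFinite
  calc P.map Ω T = P (Ω ⁻¹' T) := Measure.map_apply hΩ.measurable T.measurableSet
    _ = ∑ A ∈ T, P (Ω ⁻¹' {A}) :=
        (sum_measure_preimage_singleton T fun A _ =>
          hΩ.measurable (measurableSet_singleton A)).symm
    _ = ∑ A ∈ T, if A.card = s then (((Fintype.card ι).choose s : ℕ) : ENNReal)⁻¹ else 0 :=
        Finset.sum_congr rfl fun A _ => hΩ.prob_eq A
    _ = ({A ∈ T | A.card = s}.card : ENNReal) / (Fintype.card ι).choose s := by
        rw [← Finset.sum_filter, Finset.sum_const, nsmul_eq_mul, div_eq_mul_inv]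
    _ = _ := by rw [← Set.ncard_coe_finset, Finset.coe_filter]; rfl

variable {γ : Type*} [MeasurableSpace γ] {Y : W → γ} {good : γ → Finset ι → Prop}

omit [Fintype ι] in
theorem measurableSet_setOf_prod_finset [Finite ι] (hgood : ∀ A, MeasurableSet {y | good y A}) :
    MeasurableSet {x : γ × Finset ι | good x.1 x.2} :=
  measurableSet_setOfPred.2 <| measurable_from_prod_countable_left fun A =>
    measurableSet_setOfPred.1 (hgood A)

theorem IsUniformSample.le_measure_setOf [IsProbabilityMeasure P] (hΩ : IsUniformSample P s Ω)
    (hY : Measurable Y) (hind : IndepFun Y Ω P) (hgood : ∀ A, MeasurableSet {y | good y A})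
    (hs : s ≤ Fintype.card ι) {p : ℝ} (hp : 0 ≤ p)
    (hcount : ∀ y, ({A | ¬ good y A ∧ A.card = s}.ncard : ℝ) ≤ p * (Fintype.card ι).choose s) :
    ENNReal.ofReal (1 - p) ≤ P {w | good (Y w) (Ω w)} := by
  have hmeas : MeasurableSet {x : γ × Finset ι | good x.1 x.2} :=
    measurableSet_setOf_prod_finset hgood
  have hchoose : (0 : ℝ) < (Fintype.card ι).choose s := by exact_mod_cast Nat.choose_pos hs
  have : IsProbabilityMeasure (P.map Y) := Measure.isProbabilityMeasure_map hY.aemeasurable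
  have hsection (y : γ) : P.map Ω {A | ¬ good y A} ≤ ENNReal.ofReal p := by
    rw [hΩ.map_apply, ← ENNReal.ofReal_natCast, ← ENNReal.ofReal_natCast,
      ← ENNReal.ofReal_div_of_pos hchoose]
    exact ENNReal.ofReal_le_ofReal ((div_le_iff₀ hchoose).2 (hcount y))
  have hbad : P {w | good (Y w) (Ω w)}ᶜ ≤ ENNReal.ofReal p := by
    calc P {w | good (Y w) (Ω w)}ᶜ
        = P.map (fun w => (Y w, Ω w)) {x | good x.1 x.2}ᶜ :=
          (Measure.map_apply (hY.prodMk hΩ.measurable) hmeas.compl).symm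
      _ = ∫⁻ y, P.map Ω {A | ¬ good y A} ∂P.map Y := by
          rw [(indepFun_iff_map_prod_eq_prod_map_map hY.aemeasurable
            hΩ.measurable.aemeasurable).1 hind, Measure.prod_apply hmeas.compl]
          rfl
      _ ≤ ∫⁻ _, ENNReal.ofReal p ∂P.map Y := lintegral_mono hsection
      _ = ENNReal.ofReal p := by rw [lintegral_const, measure_univ, mul_one]
  have hevent : MeasurableSet {w | good (Y w) (Ω w)} := hY.prodMk hΩ.measurable hmeas
  rw [prob_compl_eq_one_sub hevent] at hbad
  rw [ENNReal.ofReal_sub _ hp, ENNReal.ofReal_one]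
  exact tsub_le_iff_tsub_le.1 hbad

end Uniform

section LowRankNet

variable {ι κ : Type*} [Fintype ι] [Fintype κ]

theorem exists_mul_transpose_mul_eq_of_rank_le {Z : Matrix ι κ ℝ} {r : ℕ} (hr : Z.rank ≤ r) :
    ∃ A : Matrix ι (Fin r) ℝ, A * (Aᵀ * Z) = Z ∧ ∀ i k, |A i k| ≤ 1 := by
  classical
  set T := Matrix.toEuclideanLin Z
  have hrank : Module.finrank ℝ T.range = Z.rank := by
    rw [Matrix.rank_eq_finrank_range_toLin Z (EuclideanSpace.basisFun _ ℝ).toBasis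
      (EuclideanSpace.basisFun _ ℝ).toBasis, ← Matrix.toEuclideanLin_eq_toLin_orthonormal]
  obtain ⟨q, rfl⟩ := Nat.exists_eq_add_of_le (hrank ▸ hr)
  set e := stdOrthonormalBasis ℝ T.range
  set u : Fin (Module.finrank ℝ T.range + q) → EuclideanSpace ℝ ι :=
    Fin.append (fun k => (e k : EuclideanSpace ℝ ι)) fun _ => 0
  have hu (k) : ‖u k‖ ≤ 1 := by
    induction k using Fin.addCases with
    | left k => simp only [u, Fin.append_left]; exact (e.orthonormal.1 k).le
    | right k => simp only [u, Fin.append_right, norm_zero, zero_le_one]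
  have hcolumn (j) : ∑ k, inner ℝ (u k) (WithLp.toLp 2 (Z.col j)) • u k
      = WithLp.toLp 2 (Z.col j) := by
    have hmem : WithLp.toLp 2 (Z.col j) ∈ T.range :=
      ⟨EuclideanSpace.single j 1, by
        ext i; simp [T, Matrix.toEuclideanLin, Matrix.mulVec, dotProduct, Pi.single_apply]⟩
    rw [Fin.sum_univ_add]
    simp only [u, Fin.append_left, Fin.append_right, smul_zero, Finset.sum_const_zero, add_zero]
    simpa [e.repr_apply_apply] using congrArg Subtype.val (e.sum_repr ⟨_, hmem⟩)
  refine ⟨Matrix.of fun i k => u k i, ?_, fun i k => (PiLp.norm_apply_le (u k) i).trans (hu k)⟩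
  ext i j
  have hentry := congrArg (fun v => v i) (hcolumn j)
  simpa [Matrix.mul_apply, PiLp.inner_apply, mul_comm] using hentry

theorem exists_mul_eq_of_rank_le {Z : Matrix ι κ ℝ} {r : ℕ} (hr : Z.rank ≤ r) {c : ℝ}
    (hZ : ∀ i j, |Z i j| ≤ c) :
    ∃ (A : Matrix ι (Fin r) ℝ) (B : Matrix (Fin r) κ ℝ), A * B = Z ∧
      (∀ i k, |A i k| ≤ 1) ∧ ∀ k j, |B k j| ≤ Fintype.card ι * c := by
  obtain ⟨A, hAZ, hA⟩ := exists_mul_transpose_mul_eq_of_rank_le hr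
  refine ⟨A, Aᵀ * Z, hAZ, hA, fun k j => ?_⟩
  calc |(Aᵀ * Z) k j| ≤ ∑ i, |A i k * Z i j| := Finset.abs_sum_le_sum_abs _ _
    _ ≤ ∑ _i : ι, c := Finset.sum_le_sum fun i _ => by
        rw [abs_mul]
        exact (mul_le_of_le_one_left (abs_nonneg _) (hA i k)).trans (hZ i j)
    _ = Fintype.card ι * c := by simp

omit [Fintype ι] [Fintype κ] in
theorem abs_mul_apply_sub_mul_apply_le {γ : Type*} [Fintype γ] {A A' : Matrix ι γ ℝ}
    {B B' : Matrix γ κ ℝ} {a b η : ℝ} (hA : ∀ i k, |A i k| ≤ a) (hB' : ∀ k j, |B' k j| ≤ b)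
    (hAA' : ∀ i k, |A i k - A' i k| ≤ η) (hBB' : ∀ k j, |B k j - B' k j| ≤ η) (i : ι) (j : κ) :
    |(A * B) i j - (A' * B') i j| ≤ Fintype.card γ * ((a + b) * η) := by
  have hterm (k) : |A i k * B k j - A' i k * B' k j| ≤ (a + b) * η := by
    calc |A i k * B k j - A' i k * B' k j|
        = |A i k * (B k j - B' k j) + (A i k - A' i k) * B' k j| := by ring_nf
      _ ≤ |A i k| * |B k j - B' k j| + |A i k - A' i k| * |B' k j| := by
          rw [← abs_mul, ← abs_mul]; exact abs_add_le _ _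
      _ ≤ a * η + η * b := by
          have ha := (abs_nonneg _).trans (hA i k)
          have hη := (abs_nonneg _).trans (hAA' i k)
          gcongr
          exacts [hA i k, hBB' k j, hAA' i k, hB' k j]
      _ = (a + b) * η := by ring
  calc |(A * B) i j - (A' * B') i j| = |∑ k, (A i k * B k j - A' i k * B' k j)| := by
        rw [Finset.sum_sub_distrib]; rfl
    _ ≤ ∑ k, |A i k * B k j - A' i k * B' k j| := Finset.abs_sum_le_sum_abs _ _
    _ ≤ ∑ _k : γ, (a + b) * η := Finset.sum_le_sum fun k _ => hterm k
    _ = Fintype.card γ * ((a + b) * η) := by simp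

theorem exists_finset_abs_sub_le (b : ℕ) {q : ℕ} (hq : 0 < q) :
    ∃ G : Finset ℝ, G.card ≤ 2 * (b * q) + 1 ∧ (∀ y ∈ G, |y| ≤ b) ∧
      ∀ x : ℝ, |x| ≤ b → ∃ y ∈ G, |x - y| ≤ 1 / q := by
  have hq' : (0 : ℝ) < q := Nat.cast_pos.2 hq
  refine ⟨(Finset.Icc (-(b * q : ℤ)) (b * q)).image fun k : ℤ => (k : ℝ) / q, ?_, ?_, ?_⟩
  · refine Finset.card_image_le.trans ?_
    rw [Int.card_Icc]
    lia
  · simp only [Finset.forall_mem_image, Finset.mem_Icc, ← abs_le]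
    intro k hk
    rw [abs_div, abs_of_pos hq', div_le_iff₀ hq']
    exact_mod_cast hk
  · intro x hx
    obtain ⟨hlower, hupper⟩ := abs_le.1 hx
    refine ⟨⌊x * q⌋ / q, Finset.mem_image_of_mem _ (Finset.mem_Icc.2 ⟨?_, ?_⟩), ?_⟩
    · rw [Int.le_floor]
      push_cast
      rw [← neg_mul]
      gcongr
    · refine Int.floor_le_iff.2 ?_
      push_cast
      exact (mul_le_mul_of_nonneg_right hupper hq'.le).trans_lt (lt_add_one _)
    · have hfract : x - ⌊x * q⌋ / q = Int.fract (x * q) / q := by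
        rw [Int.fract]
        field_simp
      rw [hfract, abs_div, abs_of_pos hq', Int.abs_fract]
      gcongr
      exact (Int.fract_lt_one _).le

theorem exists_finset_matrix (ι κ : Type*) [Fintype ι] [Fintype κ] (G : Finset ℝ) :
    ∃ S : Finset (Matrix ι κ ℝ), S.card = G.card ^ (Fintype.card ι * Fintype.card κ) ∧
      ∀ A, A ∈ S ↔ ∀ i j, A i j ∈ G := by
  classical
  refine ⟨(Fintype.piFinset fun _ => Fintype.piFinset fun _ => G).map Matrix.of.toEmbedding, ?_,
    fun A => ?_⟩
  · simp [← pow_mul, mul_comm]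
  · simp [Finset.mem_map_equiv]

/-- `N` is an `ε`-net, in the entrywise maximum norm, for the matrices of rank at most `r` whose
entries are at most `c` in absolute value; the points of `N` itself need not have low rank. -/
def IsLowRankNet (r : ℕ) (c ε : ℝ) (N : Finset (Matrix ι κ ℝ)) : Prop :=
  ∀ Z : Matrix ι κ ℝ, Z.rank ≤ r → (∀ i j, |Z i j| ≤ c) → ∃ Z' ∈ N, ∀ i j, |Z i j - Z' i j| ≤ ε

theorem exists_isLowRankNet (ι κ : Type*) [Fintype ι] [Fintype κ] (r : ℕ) {c q : ℕ} {ε : ℝ}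
    (hc : 0 < c) (hq : 0 < q) (hε : r * (1 + Fintype.card ι * c) ≤ ε * q) :
    ∃ N : Finset (Matrix ι κ ℝ), IsLowRankNet r c ε N ∧
      N.card ≤ (2 * (Fintype.card ι * c * q) + 1) ^ ((Fintype.card ι + Fintype.card κ) * r) := by
  classical
  obtain ⟨G, hGcard, hG, happrox⟩ := exists_finset_abs_sub_le (Fintype.card ι * c) hq
  obtain ⟨S, hScard, hS⟩ := exists_finset_matrix ι (Fin r) G
  obtain ⟨T, hTcard, hT⟩ := exists_finset_matrix (Fin r) κ G
  refine ⟨Finset.image₂ (· * ·) S T, fun Z hZr hZ => ?_, ?_⟩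
  · obtain ⟨A, B, rfl, hA, hB⟩ := exists_mul_eq_of_rank_le hZr hZ
    have hA_le (i k) : |A i k| ≤ (Fintype.card ι * c : ℕ) := (hA i k).trans <| by
      exact_mod_cast Nat.mul_pos (Fintype.card_pos_iff.2 ⟨i⟩) hc
    have hB_le (k j) : |B k j| ≤ (Fintype.card ι * c : ℕ) := by exact_mod_cast hB k j
    choose A' hA'G hA' using fun i k => happrox (A i k) (hA_le i k)
    choose B' hB'G hB' using fun k j => happrox (B k j) (hB_le k j)
    refine ⟨Matrix.of A' * Matrix.of B', Finset.mem_image₂_of_mem ((hS _).2 hA'G)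
      ((hT _).2 hB'G), fun i j => ?_⟩
    refine (abs_mul_apply_sub_mul_apply_le hA (fun k j => hG _ (hB'G k j)) hA' hB' i j).trans ?_
    rw [Fintype.card_fin, mul_one_div, ← mul_div_assoc, div_le_iff₀ (Nat.cast_pos.2 hq)]
    exact_mod_cast hε
  · calc (Finset.image₂ (· * ·) S T).card ≤ S.card * T.card := Finset.card_image₂_le _ _ _
      _ = G.card ^ ((Fintype.card ι + Fintype.card κ) * r) := by
          rw [hScard, hTcard, Fintype.card_fin]
          ring
      _ ≤ _ := Nat.pow_le_pow_left hGcard _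

omit [Fintype ι] in
theorem IsLowRankNet.exists_mem_abs_sub_smul_le {r : ℕ} {c ε δ : ℝ} {N : Finset (Matrix ι κ ℝ)}
    (hN : IsLowRankNet r c ε N) (hc : 0 ≤ c) (hδ : 0 ≤ δ) {X : Matrix ι κ ℝ} (hr : X.rank ≤ r)
    (hX : ∀ i j, |X i j| ≤ c * δ) : ∃ Z ∈ N, ∀ i j, |(X - δ • Z) i j| ≤ ε * δ := by
  have hsmul : δ • δ⁻¹ • X = X := by
    rcases hδ.eq_or_lt with rfl | hδ
    · ext i j
      have hij := hX i j
      rw [mul_zero, abs_nonpos_iff] at hij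
      simp [hij]
    · exact smul_inv_smul₀ hδ.ne' X
  have hrank : (δ⁻¹ • X).rank ≤ r := by
    classical
    rw [← Matrix.mul_one X, ← Matrix.mul_smul]
    exact (Matrix.rank_mul_le_left _ _).trans hr
  obtain ⟨Z, hZ, happrox⟩ := hN (δ⁻¹ • X) hrank fun i j => by
    rw [Matrix.smul_apply, smul_eq_mul, abs_mul, abs_inv, abs_of_nonneg hδ]
    exact inv_mul_le_of_le_mul₀ hδ hc ((hX i j).trans_eq (mul_comm _ _))
  refine ⟨Z, hZ, fun i j => ?_⟩
  rw [← hsmul, ← smul_sub, Matrix.smul_apply, smul_eq_mul, abs_mul, abs_of_nonneg hδ, mul_comm]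
  exact mul_le_mul_of_nonneg_right (happrox i j) hδ

end LowRankNet

section RootMeanSquare

variable {m n : ℕ} {Ω : Finset (Fin m × Fin n)} {D R S : Matrix (Fin m) (Fin n) ℝ}

theorem maxEntry_nonneg : 0 ≤ maxEntry D :=
  Real.iSup_nonneg fun _ => abs_nonneg _

theorem abs_le_maxEntry (i : Fin m) (j : Fin n) : |D i j| ≤ maxEntry D :=
  le_ciSup (f := fun p : Fin m × Fin n => |D p.1 p.2|) (Set.finite_range _).bddAbove (i, j)

/-- The root mean square of the entries of `R` at the positions in `Ω` (zero if `Ω` is empty). -/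
def rms (Ω : Finset (Fin m × Fin n)) (R : Matrix (Fin m) (Fin n) ℝ) : ℝ :=
  ‖proj Ω R‖ / √(Ω.card : ℝ)

theorem rms_nonneg : 0 ≤ rms Ω R := by
  unfold rms
  positivity

theorem rms_univ : rms Finset.univ R = ‖R‖ / √((m : ℝ) * n) := by
  have hproj : proj Finset.univ R = R := by ext i j; simp [proj]
  simp [rms, hproj]

theorem sq_rms : rms Ω R ^ 2 = 𝔼 p ∈ Ω, R p.1 p.2 ^ 2 := by
  rw [rms, div_pow, sq_norm_proj, Real.sq_sqrt (Nat.cast_nonneg _), Finset.expect_eq_sum_div_card]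

theorem rms_sub_comm : rms Ω (R - S) = rms Ω (S - R) := by
  simp only [rms, proj_sub, norm_sub_rev]

theorem rms_sub_le : rms Ω (D - S) ≤ rms Ω (D - R) + rms Ω (R - S) := by
  simp only [rms, proj_sub, ← add_div]
  gcongr
  exact norm_sub_le_norm_sub_add_norm_sub _ _ _

theorem rms_le_of_forall_abs_le {c : ℝ} (hc : 0 ≤ c) (h : ∀ i j, |R i j| ≤ c) : rms Ω R ≤ c := by
  refine le_of_sq_le_sq ?_ hc
  rw [sq_rms]
  rcases Ω.eq_empty_or_nonempty with rfl | hΩ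
  · simpa using sq_nonneg c
  · exact Finset.expect_le hΩ fun p _ => sq_le_sq.2 ((h p.1 p.2).trans (le_abs_self c))

end RootMeanSquare

section RepresentativeSample

variable {m n s : ℕ} {N : Finset (Matrix (Fin m) (Fin n) ℝ)} {τ : ℝ}
  {Ω : Finset (Fin m × Fin n)} {D : Matrix (Fin m) (Fin n) ℝ}

/-- The sample `Ω` represents the residuals `D - δ Z`, where `δ` is the largest entry of `D` and `Z`
runs over `N`: their mean square over all positions exceeds the one over `Ω` by at most `(3τδ)²`.
Only residuals with entries at most `3δ` are considered, as those of the net points near a matrix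
within `2δ` of `D` are. -/
def IsRepresentative (N : Finset (Matrix (Fin m) (Fin n) ℝ)) (τ : ℝ) (D : Matrix (Fin m) (Fin n) ℝ)
    (Ω : Finset (Fin m × Fin n)) : Prop :=
  ∀ Z ∈ N, (∀ i j, |(D - maxEntry D • Z) i j| ≤ 3 * maxEntry D) →
    rms Finset.univ (D - maxEntry D • Z) ^ 2
      ≤ rms Ω (D - maxEntry D • Z) ^ 2 + (τ * (3 * maxEntry D)) ^ 2

theorem IsRepresentative.rms_univ_sub_le {r : ℕ} {ε : ℝ} (h : IsRepresentative N τ D Ω)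
    (hN : IsLowRankNet r 3 ε N) (hτ : 0 ≤ τ) (hε : 0 ≤ ε) (hε' : ε ≤ 1)
    {X : Matrix (Fin m) (Fin n) ℝ} (hr : X.rank ≤ r)
    (hX : ∀ i j, |D i j - X i j| ≤ 2 * maxEntry D) :
    rms Finset.univ (D - X) ≤ rms Ω (D - X) + (3 * τ + 2 * ε) * maxEntry D := by
  set δ := maxEntry D
  have hδ : 0 ≤ δ := maxEntry_nonneg
  obtain ⟨Z, hZN, hZ⟩ := hN.exists_mem_abs_sub_smul_le (by norm_num) hδ hr fun i j => by
    have hDX := abs_sub_abs_le_abs_sub (X i j) (D i j)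
    rw [abs_sub_comm] at hDX
    linarith [hX i j, abs_le_maxEntry (D := D) i j]
  have hresidual (i j) : |(D - δ • Z) i j| ≤ 3 * δ := by
    rw [← sub_add_sub_cancel D X, Matrix.add_apply]
    refine (abs_add_le _ _).trans ?_
    rw [Matrix.sub_apply D X]
    linarith [hX i j, hZ i j, mul_le_of_le_one_left hδ hε']
  have hnet : rms Finset.univ (D - δ • Z) ≤ rms Ω (D - δ • Z) + τ * (3 * δ) := by
    have hrms := rms_nonneg (Ω := Ω) (R := D - δ • Z)
    have hτδ : 0 ≤ τ * (3 * δ) := by positivity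
    refine le_of_sq_le_sq ((h Z hZN hresidual).trans ?_) (by positivity)
    rw [add_sq]
    linarith [mul_nonneg hrms hτδ]
  have herror (Ω' : Finset (Fin m × Fin n)) : rms Ω' (X - δ • Z) ≤ ε * δ :=
    rms_le_of_forall_abs_le (by positivity) hZ
  calc rms Finset.univ (D - X)
      ≤ rms Finset.univ (D - δ • Z) + rms Finset.univ (X - δ • Z) :=
        rms_sub_le.trans_eq (congrArg _ rms_sub_comm)
    _ ≤ rms Ω (D - δ • Z) + τ * (3 * δ) + ε * δ := add_le_add hnet (herror _)
    _ ≤ rms Ω (D - X) + rms Ω (X - δ • Z) + τ * (3 * δ) + ε * δ := by gcongr; exact rms_sub_le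
    _ ≤ rms Ω (D - X) + (3 * τ + 2 * ε) * δ := by linarith [herror Ω]

theorem ncard_sq_rms_add_lt_le {R : Matrix (Fin m) (Fin n) ℝ} {b : ℝ} (hb : 0 ≤ b)
    (hR : ∀ i j, |R i j| ≤ b) (τ : ℝ) (hs : s ≤ m * n) :
    ({A | rms A R ^ 2 + (τ * b) ^ 2 < rms Finset.univ R ^ 2 ∧ A.card = s}.ncard : ℝ)
      ≤ Real.exp (-(s * τ ^ 4 / 2)) * (m * n).choose s := by
  rcases hb.eq_or_lt with rfl | hb
  · have hzero : rms Finset.univ R = 0 := (rms_le_of_forall_abs_le le_rfl hR).antisymm rms_nonneg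
    have hempty : {A | rms A R ^ 2 + (τ * 0) ^ 2 < rms Finset.univ R ^ 2 ∧ A.card = s} = ∅ := by
      refine Set.eq_empty_of_forall_notMem fun A hA => ?_
      nlinarith [hA.1, sq_nonneg (rms A R)]
    rw [hempty, Set.ncard_empty, Nat.cast_zero]
    positivity
  · have hsq (p) (_ : p ∈ (Finset.univ : Finset (Fin m × Fin n))) :
        R p.1 p.2 ^ 2 ∈ Set.Icc 0 (b ^ 2) :=
      ⟨sq_nonneg _, sq_le_sq.2 ((hR p.1 p.2).trans (le_abs_self b))⟩
    have hcard : (Finset.univ : Finset (Fin m × Fin n)).card = m * n := by simp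
    have htail := card_expect_add_lt_expect_le hsq (sq_nonneg (τ * b)) (hs.trans_eq hcard.symm)
    have hexponent : s * ((τ * b) ^ 2) ^ 2 / (2 * (b ^ 2 - 0) ^ 2) = s * τ ^ 4 / 2 := by
      field_simp
      ring
    rw [hexponent, hcard, mul_comm _ (Real.exp _), ← Set.ncard_coe_finset] at htail
    simpa only [sq_rms, Finset.coe_filter, Finset.mem_powersetCard_univ, and_comm] using htail

theorem ncard_not_isRepresentative_le (N : Finset (Matrix (Fin m) (Fin n) ℝ)) (τ : ℝ)
    (D : Matrix (Fin m) (Fin n) ℝ) (hs : s ≤ m * n) :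
    ({A | ¬ IsRepresentative N τ D A ∧ A.card = s}.ncard : ℝ)
      ≤ N.card * Real.exp (-(s * τ ^ 4 / 2)) * (m * n).choose s := by
  classical
  set δ := maxEntry D
  set N' := {Z ∈ N | ∀ i j, |(D - δ • Z) i j| ≤ 3 * δ}
  set bad : Matrix (Fin m) (Fin n) ℝ → Set (Finset (Fin m × Fin n)) := fun Z =>
    {A | rms A (D - δ • Z) ^ 2 + (τ * (3 * δ)) ^ 2 < rms Finset.univ (D - δ • Z) ^ 2 ∧ A.card = s}
  have hcover : {A | ¬ IsRepresentative N τ D A ∧ A.card = s} ⊆ ⋃ Z ∈ N', bad Z := by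
    rintro A ⟨hA, hcard⟩
    rw [IsRepresentative] at hA
    push Not at hA
    obtain ⟨Z, hZ, hentry, hlt⟩ := hA
    exact Set.mem_biUnion (Finset.mem_filter.2 ⟨hZ, hentry⟩) ⟨hlt, hcard⟩
  calc ({A | ¬ IsRepresentative N τ D A ∧ A.card = s}.ncard : ℝ)
      ≤ (⋃ Z ∈ N', bad Z).ncard := by exact_mod_cast Set.ncard_le_ncard hcover (Set.toFinite _)
    _ ≤ ∑ Z ∈ N', ((bad Z).ncard : ℝ) := by exact_mod_cast Finset.set_ncard_biUnion_le _ _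
    _ ≤ ∑ _Z ∈ N', Real.exp (-(s * τ ^ 4 / 2)) * (m * n).choose s :=
        Finset.sum_le_sum fun Z hZ => ncard_sq_rms_add_lt_le
          (mul_nonneg (by norm_num) maxEntry_nonneg) (Finset.mem_filter.1 hZ).2 τ hs
    _ = N'.card * Real.exp (-(s * τ ^ 4 / 2)) * (m * n).choose s := by
        rw [Finset.sum_const, nsmul_eq_mul, mul_assoc]
    _ ≤ N.card * Real.exp (-(s * τ ^ 4 / 2)) * (m * n).choose s := by
        gcongr
        exact Finset.filter_subset _ _

theorem measurableSet_isRepresentative {β : Type*} [MeasurableSpace β]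
    {D : β → Matrix (Fin m) (Fin n) ℝ} (hD : ∀ i j, Measurable fun y => D y i j)
    (N : Finset (Matrix (Fin m) (Fin n) ℝ)) (τ : ℝ) (A : Finset (Fin m × Fin n)) :
    MeasurableSet {y | IsRepresentative N τ (D y) A} := by
  have hmax : Measurable fun y => maxEntry (D y) := Measurable.iSup fun p => (hD p.1 p.2).abs
  have hres (Z : Matrix (Fin m) (Fin n) ℝ) (i j) :
      Measurable fun y => (D y - maxEntry (D y) • Z) i j := (hD i j).sub (hmax.mul_const (Z i j))
  have hrms (Z : Matrix (Fin m) (Fin n) ℝ) (Ω : Finset (Fin m × Fin n)) :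
      Measurable fun y => rms Ω (D y - maxEntry (D y) • Z) ^ 2 := by
    simp only [sq_rms, Finset.expect_eq_sum_div_card]
    exact (Finset.measurable_sum _ fun p _ => (hres Z p.1 p.2).pow_const 2).div_const _
  have hbound (Z : Matrix (Fin m) (Fin n) ℝ) : MeasurableSet
      {y | ∀ i j, |(D y - maxEntry (D y) • Z) i j| ≤ 3 * maxEntry (D y)} := by
    simp only [Set.ofPred_forall]
    exact .iInter fun i => .iInter fun j =>
      measurableSet_le (hres Z i j).abs (hmax.const_mul 3)
  have hdeviation (Z : Matrix (Fin m) (Fin n) ℝ) : MeasurableSet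
      {y | rms Finset.univ (D y - maxEntry (D y) • Z) ^ 2
        ≤ rms A (D y - maxEntry (D y) • Z) ^ 2 + (τ * (3 * maxEntry (D y))) ^ 2} :=
    measurableSet_le (hrms Z _) ((hrms Z A).add (((hmax.const_mul 3).const_mul τ).pow_const 2))
  simp only [IsRepresentative, Set.ofPred_forall]
  exact .biInter N.countable_toSet fun Z _ => (hbound Z).imp (hdeviation Z)

theorem exists_event_isRepresentative {W : Type*} [MeasurableSpace W] {P : Measure W}
    [IsProbabilityMeasure P] {D : W → Matrix (Fin m) (Fin n) ℝ} {Ω : W → Finset (Fin m × Fin n)}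
    (hD : ∀ i j, Measurable fun w => D w i j) (hΩ : IsUniformSample P s Ω)
    (hind : IndepFun (fun w (p : Fin m × Fin n) => D w p.1 p.2) Ω P) (hs : s ≤ m * n)
    (N : Finset (Matrix (Fin m) (Fin n) ℝ)) (τ : ℝ) :
    ∃ G : Set W, MeasurableSet G ∧
      ENNReal.ofReal (1 - N.card * Real.exp (-(s * τ ^ 4 / 2))) ≤ P G ∧
      ∀ w ∈ G, IsRepresentative N τ (D w) (Ω w) ∧ (Ω w).card = s := by
  have hY : Measurable fun w (p : Fin m × Fin n) => D w p.1 p.2 :=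
    measurable_pi_lambda _ fun p => hD p.1 p.2
  have hcard : Fintype.card (Fin m × Fin n) = m * n := by simp
  set good : (Fin m × Fin n → ℝ) → Finset (Fin m × Fin n) → Prop := fun y A =>
    IsRepresentative N τ (Matrix.of (Function.curry y)) A ∧ A.card = s
  have hgood (A) : MeasurableSet {y | good y A} :=
    (measurableSet_isRepresentative (fun i j => measurable_pi_apply (i, j)) N τ A).inter (.const _)
  refine ⟨{w | good (fun p => D w p.1 p.2) (Ω w)},
    hY.prodMk hΩ.measurable (measurableSet_setOf_prod_finset hgood),
    hΩ.le_measure_setOf hY hind hgood (hs.trans_eq hcard.symm) (by positivity) fun y => ?_,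
    fun w hw => hw⟩
  have hiff (A) : ¬ good y A ∧ A.card = s
      ↔ ¬ IsRepresentative N τ (Matrix.of (Function.curry y)) A ∧ A.card = s := by tauto
  simp only [hiff, hcard]
  exact ncard_not_isRepresentative_le N τ _ hs

end RepresentativeSample

section UniformDeviation

variable {m n r s : ℕ}

/-- The rate, up to a constant and the size of the entries, at which the mean square over `s`
sampled positions controls the error of all matrices of rank at most `r` with `m` rows and at most
`m` columns. -/
def deviationRate (m r s : ℕ) : ℝ :=
  ((m : ℝ) * r * Real.log m / s) ^ (1 / 4 : ℝ)

theorem deviationRate_nonneg : 0 ≤ deviationRate m r s := by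
  unfold deviationRate
  positivity

theorem deviationRate_pow_four : deviationRate m r s ^ 4 = m * r * Real.log m / s := by
  rw [deviationRate, ← Real.rpow_natCast, ← Real.rpow_mul (by positivity)]
  norm_num

theorem deviationRate_mono {r' : ℕ} (h : r ≤ r') : deviationRate m r s ≤ deviationRate m r' s := by
  unfold deviationRate
  gcongr

theorem half_le_log_natCast (hm : 2 ≤ m) : 1 / 2 ≤ Real.log m := by
  have hlog : Real.log 2 ≤ Real.log m := Real.log_le_log two_pos (by exact_mod_cast hm)
  linarith [Real.log_two_gt_d9]

theorem one_div_le_deviationRate (hm : 2 ≤ m) (hr : 1 ≤ r) (hs : 0 < s) (hsm : s ≤ m * m) :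
    1 / (m : ℝ) ≤ deviationRate m r s := by
  have hm' : (2 : ℝ) ≤ m := by exact_mod_cast hm
  have hsm' : (s : ℝ) ≤ m * m := by exact_mod_cast hsm
  have hrlog : 1 * (1 / 2) ≤ (r : ℝ) * Real.log m := by
    gcongr
    exacts [by exact_mod_cast hr, half_le_log_natCast hm]
  refine le_of_pow_le_pow_left₀ four_ne_zero deviationRate_nonneg ?_
  rw [deviationRate_pow_four, one_div_pow, div_le_div_iff₀ (by positivity) (Nat.cast_pos.2 hs)]
  calc 1 * (s : ℝ) ≤ m * m := by rwa [one_mul]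
    _ ≤ m * (1 * (1 / 2)) * m ^ 4 := by
        have hcube : (2 : ℝ) ^ 3 ≤ m ^ 3 := by gcongr
        nlinarith [mul_nonneg (sq_nonneg (m : ℝ)) (sub_nonneg.2 hcube)]
    _ ≤ m * (r * Real.log m) * m ^ 4 := by gcongr
    _ = m * r * Real.log m * m ^ 4 := by ring

theorem net_card_le_exp (hm : 2 ≤ m) (hnm : n ≤ m) (r : ℕ) :
    (((24 * m ^ 4 + 1) ^ ((m + n) * r) : ℕ) : ℝ) ≤ Real.exp (18 * (m * r * Real.log m)) := by
  have hbase : 24 * m ^ 4 + 1 ≤ m ^ 9 := by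
    calc 24 * m ^ 4 + 1 ≤ 2 ^ 5 * m ^ 4 := by
          have := Nat.pow_pos (n := 4) (zero_lt_two.trans_le hm)
          lia
      _ ≤ m ^ 5 * m ^ 4 := by gcongr
      _ = m ^ 9 := by ring
  have hm₀ : (0 : ℝ) < m := Nat.cast_pos.2 (zero_lt_two.trans_le hm)
  calc (((24 * m ^ 4 + 1) ^ ((m + n) * r) : ℕ) : ℝ)
      ≤ (((m ^ 9) ^ ((m + m) * r) : ℕ) : ℝ) := by
        have : 1 ≤ m ^ 9 := Nat.one_le_pow _ _ (zero_lt_two.trans_le hm)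
        exact Nat.cast_le.2 ((Nat.pow_le_pow_left hbase _).trans
          (Nat.pow_le_pow_right this (by gcongr)))
    _ = Real.exp (18 * (m * r * Real.log m)) := by
        rw [← pow_mul, Nat.cast_pow, ← Real.rpow_natCast, Real.rpow_def_of_pos hm₀]
        push_cast
        ring_nf

theorem net_card_mul_exp_le (hm : 2 ≤ m) (hnm : n ≤ m) (hr : 1 ≤ r) (hs : 0 < s) :
    (((24 * m ^ 4 + 1) ^ ((m + n) * r) : ℕ) : ℝ)
        * Real.exp (-(s * (3 * deviationRate m r s) ^ 4 / 2)) ≤ Real.exp (-(m : ℝ)) := by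
  set q : ℝ := m * r * Real.log m
  have hexponent : s * (3 * deviationRate m r s) ^ 4 / 2 = 81 / 2 * q := by
    have : (s : ℝ) ≠ 0 := Nat.cast_ne_zero.2 hs.ne'
    rw [mul_pow, deviationRate_pow_four]
    field_simp
    ring
  have hmq : (m : ℝ) ≤ 2 * q := by
    have hrlog : 1 * (1 / 2) ≤ (r : ℝ) * Real.log m := by
      gcongr
      exacts [by exact_mod_cast hr, half_le_log_natCast hm]
    nlinarith [Nat.cast_nonneg (α := ℝ) m]
  calc _ ≤ Real.exp (18 * q) * Real.exp (-(81 / 2 * q)) := by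
        rw [hexponent]
        gcongr
        exact net_card_le_exp hm hnm r
    _ ≤ Real.exp (-(m : ℝ)) := by
        rw [← Real.exp_add, Real.exp_le_exp]
        linarith [Nat.cast_nonneg (α := ℝ) m]

theorem exists_isLowRankNet_one_div (n : ℕ) (hm : 1 ≤ m) (hrm : r ≤ m) :
    ∃ N : Finset (Matrix (Fin m) (Fin n) ℝ), IsLowRankNet r 3 (1 / m) N ∧
      N.card ≤ (24 * m ^ 4 + 1) ^ ((m + n) * r) := by
  have hm' : (1 : ℝ) ≤ m := by exact_mod_cast hm
  have hrm' : (r : ℝ) ≤ m := by exact_mod_cast hrm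
  obtain ⟨N, hN, hcard⟩ := exists_isLowRankNet (Fin m) (Fin n) r (c := 3) (q := 4 * m ^ 3)
    (ε := 1 / m) three_pos (by positivity) <| by
      calc (r : ℝ) * (1 + Fintype.card (Fin m) * (3 : ℕ)) ≤ m * (m + m * 3) := by
            rw [Fintype.card_fin]
            gcongr
            norm_num
        _ = 1 / m * (4 * m ^ 3 : ℕ) := by
            push_cast
            field_simp
            ring
  refine ⟨N, hN, hcard.trans_eq ?_⟩
  rw [Fintype.card_fin, Fintype.card_fin]
  ring

variable {d : ℕ} {W : Type*} [MeasurableSpace W] {P : Measure W} [IsProbabilityMeasure P]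
  {D : W → Matrix (Fin m) (Fin n) ℝ} {Ω : W → Finset (Fin m × Fin n)}

theorem exists_event_rms_univ_sub_le (hnm : n ≤ m) (hd : 1 ≤ d) (hs : 0 < s) (hsmn : s ≤ m * n)
    (hD : ∀ i j, Measurable fun w => D w i j) (hΩ : IsUniformSample P s Ω)
    (hind : IndepFun (fun w (p : Fin m × Fin n) => D w p.1 p.2) Ω P) :
    ∃ G : Set W, MeasurableSet G ∧ ENNReal.ofReal (1 - Real.exp (-(m : ℝ))) ≤ P G ∧
      ∀ w ∈ G, (Ω w).card = s ∧ ∀ X : Matrix (Fin m) (Fin n) ℝ, X.rank ≤ d →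
        (∀ i j, |D w i j - X i j| ≤ 2 * maxEntry (D w)) →
        rms Finset.univ (D w - X)
          ≤ rms (Ω w) (D w - X) + 11 * maxEntry (D w) * deviationRate m d s := by
  have hn : 1 ≤ n := Nat.pos_of_mul_pos_left (hs.trans_le hsmn)
  obtain rfl | hm : m = 1 ∨ 2 ≤ m := by lia
  · obtain ⟨G, hG, hPG, hcard⟩ := exists_event_isRepresentative hD hΩ hind hsmn ∅ 0
    refine ⟨G, hG, le_trans ?_ hPG, fun w hw => ⟨(hcard w hw).2, fun X _ _ => ?_⟩⟩
    · gcongr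
      simpa using (Real.exp_pos _).le
    · have hfull : Ω w = Finset.univ := Finset.eq_univ_of_card _ <| by
        rw [(hcard w hw).2, Fintype.card_prod, Fintype.card_fin, Fintype.card_fin]
        lia
      rw [hfull]
      exact le_add_of_nonneg_right
        (mul_nonneg (mul_nonneg (by norm_num) maxEntry_nonneg) deviationRate_nonneg)
  · set r := min d n
    have hr : 1 ≤ r := le_min hd hn
    obtain ⟨N, hN, hNcard⟩ :=
      exists_isLowRankNet_one_div n (one_le_two.trans hm) ((min_le_right d n).trans hnm)
    set x := deviationRate m r s
    have hx : 0 ≤ x := deviationRate_nonneg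
    have hmx : 1 / (m : ℝ) ≤ x :=
      one_div_le_deviationRate hm hr hs (hsmn.trans (Nat.mul_le_mul_left m hnm))
    have hxd : x ≤ deviationRate m d s := deviationRate_mono (min_le_left d n)
    obtain ⟨G, hG, hPG, hrep⟩ := exists_event_isRepresentative hD hΩ hind hsmn N (3 * x)
    refine ⟨G, hG, le_trans ?_ hPG, fun w hw => ⟨(hrep w hw).2, fun X hXd hX => ?_⟩⟩
    · gcongr
      refine le_trans ?_ (net_card_mul_exp_le hm hnm hr hs)
      gcongr
    · have hXr : X.rank ≤ r := le_min hXd (by simpa using X.rank_le_width)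
      have hm1 : 1 / (m : ℝ) ≤ 1 := by
        rw [one_div]
        exact Nat.cast_inv_le_one m
      refine ((hrep w hw).1.rms_univ_sub_le hN (by positivity) (by positivity) hm1 hXr hX).trans ?_
      have hδ := maxEntry_nonneg (D := D w)
      calc rms (Ω w) (D w - X) + (3 * (3 * x) + 2 * (1 / m)) * maxEntry (D w)
          ≤ rms (Ω w) (D w - X) + 11 * deviationRate m d s * maxEntry (D w) := by
            gcongr
            linarith
        _ = rms (Ω w) (D w - X) + 11 * maxEntry (D w) * deviationRate m d s := by ring

end UniformDeviation

section Recovery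

variable {m n d : ℕ} {μ c : ℝ} {Ω : Finset (Fin m × Fin n)} {X E : Matrix (Fin m) (Fin n) ℝ}
  {U : Matrix (Fin m) (Fin d) ℝ} {V : Matrix (Fin n) (Fin d) ℝ}

theorem IsCriticalPoint.norm_sub_div_le (hμ : 0 < μ)
    (h : IsCriticalPoint (objective d μ Ω (X + E)) (U, V)) (hU : U ≠ 0)
    (hc : rms Finset.univ (X + E - U * Vᵀ) ≤ rms Ω (X + E - U * Vᵀ) + c) :
    ‖X - U * Vᵀ‖ / √((m : ℝ) * n) ≤ ‖E‖ / √((m : ℝ) * n) + c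
      + μ * √(d : ℝ) / (2 * residualRatio Ω (X + E) U V * √(Ω.card : ℝ)) := by
  have hobserved : rms Ω (X + E - U * Vᵀ)
      ≤ μ * √(d : ℝ) / (2 * residualRatio Ω (X + E) U V * √(Ω.card : ℝ)) := by
    rw [← div_div]
    exact div_le_div_of_nonneg_right (h.norm_proj_le hμ hU) (Real.sqrt_nonneg _)
  calc ‖X - U * Vᵀ‖ / √((m : ℝ) * n)
      ≤ (‖E‖ + ‖X + E - U * Vᵀ‖) / √((m : ℝ) * n) := by
        gcongr
        rw [add_sub_right_comm, add_comm ‖E‖]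
        exact norm_le_add_norm_add _ _
    _ = ‖E‖ / √((m : ℝ) * n) + rms Finset.univ (X + E - U * Vᵀ) := by rw [add_div, rms_univ]
    _ ≤ _ := by linarith

end Recovery

end BiTrace

end

theorem theorem8_general (m n d s : ℕ) (hnm : n ≤ m) (hs : 0 < s) (hsmn : s ≤ m * n)
    (μ : ℝ) (hμ : 0 < μ) (X₀ : Matrix (Fin m) (Fin n) ℝ)
    {W : Type*} [MeasurableSpace W] (P : Measure W) [IsProbabilityMeasure P]
    (E : W → Matrix (Fin m) (Fin n) ℝ) (Ω : W → Finset (Fin m × Fin n))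
    (hE : ∀ i j, Measurable fun w => E w i j) (hΩ : BiTrace.IsUniformSample P s Ω)
    (hind : IndepFun (fun w (p : Fin m × Fin n) => E w p.1 p.2) Ω P) :
    ∃ G : Set W, MeasurableSet G ∧
      ENNReal.ofReal (1 - Real.exp (-(m : ℝ))) ≤ P G ∧
      ∀ w ∈ G, ∀ (U : Matrix (Fin m) (Fin d) ℝ) (V : Matrix (Fin n) (Fin d) ℝ),
        BiTrace.IsCriticalPoint (BiTrace.objective d μ (Ω w) (X₀ + E w)) (U, V) →
        U ≠ 0 →
        (∀ i j, |(X₀ + E w) i j - (U * Vᵀ) i j| ≤ 2 * BiTrace.maxEntry (X₀ + E w)) →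
        0 < BiTrace.residualRatio (Ω w) (X₀ + E w) U V ∧
        ‖X₀ - U * Vᵀ‖ / √((m : ℝ) * n) ≤
          ‖E w‖ / √((m : ℝ) * n)
          + 11 * BiTrace.maxEntry (X₀ + E w) * ((m : ℝ) * d * Real.log m / s) ^ (1 / 4 : ℝ)
          + μ * √(d : ℝ) / (2 * BiTrace.residualRatio (Ω w) (X₀ + E w) U V * √(s : ℝ)) := by
  rcases d.eq_zero_or_pos with rfl | hd
  · refine ⟨Set.univ, .univ, ?_, fun w _ U V _ hU => absurd (Subsingleton.elim U 0) hU⟩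
    rw [measure_univ, ENNReal.ofReal_le_one]
    exact sub_le_self 1 (Real.exp_pos _).le
  have hD (i j) : Measurable fun w => (X₀ + E w) i j := (hE i j).const_add (X₀ i j)
  have hind' : IndepFun (fun w (p : Fin m × Fin n) => (X₀ + E w) p.1 p.2) Ω P :=
    hind.comp (φ := fun y p => X₀ p.1 p.2 + y p) (by fun_prop) measurable_id
  obtain ⟨G, hG, hPG, hrms⟩ :=
    BiTrace.exists_event_rms_univ_sub_le hnm hd hs hsmn hD hΩ hind'
  refine ⟨G, hG, hPG, fun w hw U V hcrit hU hclose => ⟨hcrit.residualRatio_pos hU, ?_⟩⟩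
  obtain ⟨hcard, hdeviation⟩ := hrms w hw
  have hrank : (U * Vᵀ).rank ≤ d :=
    (Matrix.rank_mul_le_left _ _).trans (by simpa using U.rank_le_width)
  rw [← hcard] at hdeviation ⊢
  exact hcrit.norm_sub_div_le hμ hU (hdeviation _ hrank hclose)

theorem theorem8 :
    ∃ C₂ : ℝ, 0 < C₂ ∧
      ∀ (m n d s : ℕ), n ≤ m → 0 < s → s ≤ m * n →
      ∀ (μ : ℝ), 0 < μ →
      ∀ (X₀ : Matrix (Fin m) (Fin n) ℝ), X₀.rank ≤ d →
      ∀ (W : Type*) [MeasurableSpace W] (P : Measure W) [IsProbabilityMeasure P]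
        (E : W → Matrix (Fin m) (Fin n) ℝ) (Ω : W → Finset (Fin m × Fin n)),
        (∀ i j, Measurable fun w => E w i j) →
        BiTrace.IsUniformSample P s Ω →
        IndepFun (fun w (p : Fin m × Fin n) => E w p.1 p.2) Ω P →
        ∃ G : Set W, MeasurableSet G ∧
          ENNReal.ofReal (1 - 2 * Real.exp (-(m : ℝ))) ≤ P G ∧
          ∀ w ∈ G, ∀ (U : Matrix (Fin m) (Fin d) ℝ) (V : Matrix (Fin n) (Fin d) ℝ),
            BiTrace.IsCriticalPoint (BiTrace.objective d μ (Ω w) (X₀ + E w)) (U, V) →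
            U ≠ 0 →
            (∀ i j, |(X₀ + E w) i j - (U * Vᵀ) i j| ≤ 2 * BiTrace.maxEntry (X₀ + E w)) →
            0 < BiTrace.residualRatio (Ω w) (X₀ + E w) U V ∧
            ‖X₀ - U * Vᵀ‖ / √((m : ℝ) * n) ≤
              ‖E w‖ / √((m : ℝ) * n)
              + C₂ * BiTrace.maxEntry (X₀ + E w)
                  * ((m : ℝ) * d * Real.log m / s) ^ (1 / 4 : ℝ)
              + μ * √(d : ℝ) / (2 * BiTrace.residualRatio (Ω w) (X₀ + E w) U V * √(s : ℝ)) := by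
  refine ⟨11, by norm_num, fun m n d s hnm hs hsmn μ hμ X₀ _ W _ P _ E Ω hE hΩ hind => ?_⟩
  obtain ⟨G, hG, hPG, h⟩ := theorem8_general m n d s hnm hs hsmn μ hμ X₀ P E Ω hE hΩ hind
  exact ⟨G, hG, le_trans (by gcongr; linarith [Real.exp_pos (-(m : ℝ))]) hPG, h⟩
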